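/- For $0<p<1$ let $u_p$ be the distribution on $\{-1,1\}$ with $u_p(1)=p$ and $u_p(-1)=1-p$, let $\mu_p=2p-1$ and $\sigma_p=2\sqrt{p(1-p)}$ be its mean and standard deviation, and for $h:\{-1,1\}^n\to\{-1,1\}$ and $i\in[n]$ let $$\hat h(i,p)=\mathbb{E}_{x\sim u_p^n}\Big[h(x)\cdot\frac{x_i-\mu_p}{\sigma_p}\Big]$$ be the degree-one $p$-biased Fourier coefficient of $h$. Let $\mathrm{sign}(t)=1$ if $t\ge 0$ and $\mathrm{sign}(t)=-1$ if $t<0$. A nonzero real vector $v$ is called $\tau$-regular if $\|v\|_\infty/\|v\|_2\le\tau$. There is an absolute constant $C>0$ such that the following holds. Let $[n]=H\sqcup T$ be a partition of the coordinates into a head $H$ and a tail $T$, let $w_H\in\mathbb{R}_{\ge0}^H$, $w_T\in\mathbb{R}_{\ge 0}^T$, $w'_T\in\mathbb{R}^T$, $\theta\in\mathbb{R}$, and let $$f(x)=\mathrm{sign}(w_H\cdot x_H+w_T\cdot x_T-\theta),\qquad g(x)=\mathrm{sign}(w_H\cdot x_H+w'_T\cdot x_T-\theta)$$ on $\{-1,1\}^n$.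 Suppose that $w_T$ and $w'_T$ are $\tau$-regular and that $\|w_T\|_2=\|w'_T\|_2$. 1. If moreover $w'_T$ has nonnegative entries and $\|w_T\|_1=\|w'_T\|_1$, then for every $p\in(0,1)$ $$\sum_{i\in H}\big(\hat f(i,p)-\hat g(i,p)\big)^2\le C\,\frac{\tau^2}{\sigma_p^2}.$$ 2. For $p=\tfrac12$ the same bound holds (with $\sigma_{1/2}=1$) without the assumption $\|w_T\|_1=\|w'_T\|_1$ and without any assumption on the signs of the entries of $w'_T$. -/

import Mathlib

noncomputable section

namespace LTF

/-- The Boolean hypercube `{-1, 1}^n`; the two-element set `{-1, 1}` is the unit group of `ℤ`. -/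
abbrev Cube (n : ℕ) : Type := Fin n → ℤˣ

/-- The inclusion of `{-1, 1}` into the reals. -/
def bit (b : ℤˣ) : ℝ := ((b : ℤ) : ℝ)

/-- `sign t = 1` if `t ≥ 0`, and `sign t = -1` otherwise. -/
def sign (t : ℝ) : ℤˣ := if 0 ≤ t then 1 else -1

/-- The linear threshold function `x ↦ sign (w ⬝ x - θ)` on `{-1, 1}^n`. -/
def ltf {n : ℕ} (w : Fin n → ℝ) (θ : ℝ) : Cube n → ℤˣ :=
  fun x => sign ((∑ i, w i * bit (x i)) - θ)

/-- The `ℓ₁` norm of a real vector. -/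
def norm1 {ι : Type*} [Fintype ι] (v : ι → ℝ) : ℝ := ∑ i, |v i|

/-- The `ℓ₂` norm of a real vector. -/
def norm2 {ι : Type*} [Fintype ι] (v : ι → ℝ) : ℝ := √(∑ i, v i ^ 2)

/-- A vector `v` is `τ`-regular if it is nonzero and `‖v‖_∞ / ‖v‖₂ ≤ τ`
(the norm of `ι → ℝ` in Mathlib is the sup norm). -/
def IsRegular {ι : Type*} [Fintype ι] (τ : ℝ) (v : ι → ℝ) : Prop :=
  v ≠ 0 ∧ ‖v‖ / norm2 v ≤ τ

/-- The tail of a weight vector: its restriction to the coordinates outside the head `H`. -/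
def tail {n : ℕ} (H : Finset (Fin n)) (w : Fin n → ℝ) : {i : Fin n // i ∉ H} → ℝ :=
  fun i => w i

/-- The mean `2 p - 1` of the `p`-biased distribution on `{-1, 1}`. -/
def biasedMean (p : ℝ) : ℝ := 2 * p - 1

/-- The standard deviation `2 √(p (1 - p))` of the `p`-biased distribution on `{-1, 1}`. -/
def biasedSD (p : ℝ) : ℝ := 2 * √(p * (1 - p))

/-- The probability that the `p`-biased distribution on `{-1, 1}` gives to a point:
`p` to `1` and `1 - p` to `-1`. -/
def biasedWeight (p : ℝ) (b : ℤˣ) : ℝ := if b = 1 then p else 1 - p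

/-- The expectation of `F x`, for `x` drawn from the `n`-fold product of the `p`-biased
distribution on `{-1, 1}`. -/
def biasedExp {n : ℕ} (p : ℝ) (F : Cube n → ℝ) : ℝ :=
  ∑ x : Cube n, (∏ i, biasedWeight p (x i)) * F x

/-- The normalized bit `(b - μ_p) / σ_p`, which has mean `0` and variance `1`. -/
def normalizedBit (p : ℝ) (b : ℤˣ) : ℝ := (bit b - biasedMean p) / biasedSD p

/-- The degree-one `p`-biased Fourier coefficient of `f : {-1, 1}^n → {-1, 1}` at the
coordinate `i`. -/
def biasedCoeff {n : ℕ} (p : ℝ) (f : Cube n → ℤˣ) (i : Fin n) : ℝ :=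
  biasedExp p fun x => bit (f x) * normalizedBit p (x i)

end LTF

end

/-!
Fix the head coordinates. The conditional expectations of `f` and `g` are then affine functions
of the probabilities that two weighted sums of independent `p`-biased bits fall below a threshold.
In terms of normalized bits and `ℓ₂`-normalized weights, the assumptions on the norms say that both
sums have variance `1`, the same threshold, and coefficients at most `τ`; for `p = 1 / 2` the means
vanish, so that neither the `ℓ₁` norms nor the signs matter. A Berry–Esseen bound puts both
distribution functions within `O(τ / σ_p)` of the Gaussian one (`expect_below_sub_le`), so the
conditional expectation of `f - g` is `O(τ / σ_p)` for every assignment to the head, and Bessel's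
inequality (`sum_expect_mul_normalizedBit_sq_le`) turns this into the bound on the head coefficients.

The Berry–Esseen bound comes from Stein's method in its zero-bias form. Let `f` be the bounded
solution of `f' w - w f w = 1_{w < z} - Φ z`. For a normalized `p`-biased bit `y`,
`E[y F(y)]` is the difference quotient of `F` between the two values of `y`, whose distance is
`2 / σ_p`. Hence for `W = ∑ aᵢ yᵢ` the expectation of `W f W` is a mean, with weights `aᵢ²`, of
difference quotients of `f` over intervals within `δ = 2 τ / σ_p` of `W`. There Stein's equation
gives `f' X = W f W + 1_{X < z} - Φ z + O((1 + |W|) δ)`, and the terms `W f W` cancel. What is left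
compares `P[W < z ± δ]` with `Φ z` up to `O(δ)` (`gauss_le_expect_below`, `expect_below_le_gauss`).
-/

open Set Filter Topology MeasureTheory

namespace LTF

/-! ### Gaussian tails -/

/-- The unnormalized standard Gaussian density `x ↦ exp (-x² / 2)`. -/
noncomputable def gauss (x : ℝ) : ℝ := Real.exp (-x ^ 2 / 2)

/-- The unnormalized Gaussian mass of `(-∞, w]`. -/
noncomputable def lowerMass (w : ℝ) : ℝ := ∫ x in Iic w, gauss x

/-- The total mass `√(2π)` of the unnormalized Gaussian density. -/
noncomputable def gaussMass : ℝ := ∫ x, gauss x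

/-- The unnormalized Gaussian mass of `(w, ∞)`. -/
noncomputable def upperMass (w : ℝ) : ℝ := gaussMass - lowerMass w

lemma gauss_pos (x : ℝ) : 0 < gauss x := Real.exp_pos _

lemma gauss_neg (x : ℝ) : gauss (-x) = gauss x := by simp [gauss]

lemma gauss_le_one (x : ℝ) : gauss x ≤ 1 :=
  Real.exp_le_one_iff.2 (by nlinarith [sq_nonneg x])

lemma continuous_gauss : Continuous gauss := by unfold gauss; fun_prop

lemma gauss_eq : gauss = fun x => Real.exp (-(1 / 2) * x ^ 2) := by
  funext x; unfold gauss; congr 1; ring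

lemma integrable_gauss : Integrable gauss := by
  rw [gauss_eq]; exact integrable_exp_neg_mul_sq (by norm_num)

lemma integrable_mul_gauss : Integrable fun x => x * gauss x := by
  rw [gauss_eq]; exact integrable_mul_exp_neg_mul_sq (by norm_num)

lemma gaussMass_eq : gaussMass = √(Real.pi / (1 / 2)) := by
  unfold gaussMass; rw [gauss_eq]; exact integral_gaussian _

lemma one_le_gaussMass : 1 ≤ gaussMass := by
  rw [gaussMass_eq]; exact Real.one_le_sqrt.2 (by linarith [Real.pi_gt_three])

lemma gaussMass_le_three : gaussMass ≤ 3 := by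
  rw [gaussMass_eq]; exact Real.sqrt_le_iff.2 ⟨by norm_num, by linarith [Real.pi_lt_four]⟩

lemma lowerMass_nonneg (w : ℝ) : 0 ≤ lowerMass w :=
  setIntegral_nonneg measurableSet_Iic fun x _ => (gauss_pos x).le

lemma upperMass_eq_lowerMass_neg (w : ℝ) : upperMass w = lowerMass (-w) := by
  have h1 : lowerMass w + ∫ x in Ioi w, gauss x = gaussMass :=
    intervalIntegral.integral_Iic_add_Ioi integrable_gauss.integrableOn
      integrable_gauss.integrableOn
  have h2 := integral_comp_neg_Iic (-w) gauss
  simp only [gauss_neg, neg_neg] at h2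
  unfold upperMass
  rw [lowerMass] at h1 ⊢
  rw [lowerMass, h2]
  linarith

lemma upperMass_nonneg (w : ℝ) : 0 ≤ upperMass w := by
  rw [upperMass_eq_lowerMass_neg]; exact lowerMass_nonneg _

lemma lowerMass_le (w : ℝ) : lowerMass w ≤ gaussMass := by
  have := upperMass_nonneg w; unfold upperMass at this; linarith

lemma upperMass_le (w : ℝ) : upperMass w ≤ gaussMass := by
  have := lowerMass_nonneg w; unfold upperMass; linarith

lemma lowerMass_sub (u v : ℝ) : lowerMass v - lowerMass u = ∫ x in u..v, gauss x :=
  intervalIntegral.integral_Iic_sub_Iic integrable_gauss.integrableOn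
    integrable_gauss.integrableOn

lemma lowerMass_mono : Monotone lowerMass := fun u v h => by
  have := lowerMass_sub u v
  have h2 : 0 ≤ ∫ x in u..v, gauss x :=
    intervalIntegral.integral_nonneg h fun x _ => (gauss_pos x).le
  linarith

lemma upperMass_anti : Antitone upperMass := fun u v h => by
  have := lowerMass_mono h; unfold upperMass; linarith

lemma hasDerivAt_lowerMass (w : ℝ) : HasDerivAt lowerMass (gauss w) w := by
  have h : lowerMass = fun v => lowerMass 0 + ∫ x in (0 : ℝ)..v, gauss x := by
    funext v; rw [← lowerMass_sub]; ring
  rw [h]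
  exact (continuous_gauss.integral_hasStrictDerivAt 0 w).hasDerivAt.const_add _

lemma hasDerivAt_upperMass (w : ℝ) : HasDerivAt upperMass (-gauss w) w :=
  (hasDerivAt_lowerMass w).const_sub _

lemma continuous_lowerMass : Continuous lowerMass :=
  continuous_iff_continuousAt.2 fun w => (hasDerivAt_lowerMass w).continuousAt

lemma continuous_upperMass : Continuous upperMass := continuous_const.sub continuous_lowerMass

lemma lowerMass_sub_le {u v : ℝ} (h : u ≤ v) : lowerMass v - lowerMass u ≤ v - u := by
  rw [lowerMass_sub]
  calc ∫ x in u..v, gauss x ≤ ∫ _ in u..v, (1 : ℝ) :=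
        intervalIntegral.integral_mono_on h (continuous_gauss.intervalIntegrable u v)
          (continuous_const.intervalIntegrable u v) fun x _ => gauss_le_one x
    _ = v - u := by simp

lemma hasDerivAt_gauss (w : ℝ) : HasDerivAt gauss (-w * gauss w) w := by
  have h : HasDerivAt (fun x : ℝ => -x ^ 2 / 2) (-w) w :=
    (((hasDerivAt_pow 2 w).fun_neg).div_const 2).congr_deriv (by push_cast; ring)
  exact h.exp.congr_deriv (mul_comm _ _)

lemma tendsto_gauss_atBot : Tendsto gauss atBot (𝓝 0) := by
  refine Real.tendsto_exp_atBot.comp ?_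
  have h : Tendsto (fun x : ℝ => x ^ 2) atBot atTop := by
    simpa [sq] using tendsto_id.atBot_mul_atBot₀ (tendsto_id (α := ℝ) (x := atBot))
  have := (tendsto_neg_atTop_atBot.comp h).atBot_div_const (r := (2 : ℝ)) (by norm_num)
  simpa [Function.comp_def] using this

/-- The Mills ratio bound for the left tail: `-w ≤ -x` on `(-∞, w]`, and `-x exp (-x² / 2)` is
the derivative of `exp (-x² / 2)`. -/
lemma neg_mul_lowerMass_le (w : ℝ) : -w * lowerMass w ≤ gauss w := by
  have h1 : ∫ x in Iic w, -x * gauss x = gauss w - 0 :=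
    integral_Iic_of_hasDerivAt_of_tendsto (hasDerivAt_gauss w).continuousAt.continuousWithinAt
      (fun x _ => hasDerivAt_gauss x)
      (by simpa using integrable_mul_gauss.neg.integrableOn) tendsto_gauss_atBot
  rw [lowerMass, ← integral_const_mul, ← sub_zero (gauss w), ← h1]
  refine setIntegral_mono_on (integrable_gauss.const_mul _).integrableOn
    (by simpa using integrable_mul_gauss.neg.integrableOn) measurableSet_Iic fun x hx => ?_
  have hx : x ≤ w := hx
  exact mul_le_mul_of_nonneg_right (by linarith) (gauss_pos x).le

lemma mul_upperMass_le (w : ℝ) : w * upperMass w ≤ gauss w := by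
  have := neg_mul_lowerMass_le (-w)
  rwa [gauss_neg, neg_neg, ← upperMass_eq_lowerMass_neg] at this

/-! ### The solution of Stein's equation for a half-line -/

/-- The bounded solution of Stein's equation `f' w - w f w = 1_{w < z} - Φ z`. -/
noncomputable def steinSol (z w : ℝ) : ℝ :=
  (gauss w)⁻¹ * (lowerMass (min w z) * upperMass (max w z)) / gaussMass

/-- The derivative from the right of `steinSol z`, as given by Stein's equation. -/
noncomputable def steinDeriv (z w : ℝ) : ℝ :=
  w * steinSol z w + (if w < z then 1 else 0) - lowerMass z / gaussMass

lemma gaussMass_pos : 0 < gaussMass := zero_lt_one.trans_le one_le_gaussMass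

lemma continuous_steinSol (z : ℝ) : Continuous (steinSol z) := by
  have := continuous_gauss
  have := continuous_lowerMass
  have := continuous_upperMass
  have h : ∀ w, gauss w ≠ 0 := fun w => (gauss_pos w).ne'
  unfold steinSol
  fun_prop (disch := assumption)

lemma hasDerivAt_gauss_inv (w : ℝ) : HasDerivAt (fun x => (gauss x)⁻¹) (w * (gauss w)⁻¹) w := by
  have h := (gauss_pos w).ne'
  exact ((hasDerivAt_gauss w).fun_inv h).congr_deriv (by field_simp)

lemma hasDerivWithinAt_steinSol (z w : ℝ) :
    HasDerivWithinAt (steinSol z) (steinDeriv z w) (Ici w) w := by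
  have hg := (gauss_pos w).ne'
  have hK := gaussMass_pos.ne'
  rcases lt_or_ge w z with h | h
  · have h1 : HasDerivAt (fun x => (gauss x)⁻¹ * (lowerMass x * upperMass z) / gaussMass)
        (steinDeriv z w) w := by
      refine (((hasDerivAt_gauss_inv w).fun_mul
        ((hasDerivAt_lowerMass w).mul_const (upperMass z))).div_const gaussMass).congr_deriv ?_
      simp only [steinDeriv, steinSol, min_eq_left h.le, max_eq_right h.le, if_pos h, upperMass]
      field_simp
      ring
    refine (h1.congr_of_eventuallyEq ?_).hasDerivWithinAt
    filter_upwards [Iio_mem_nhds h] with x hx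
    have hx : x < z := hx
    simp only [steinSol, min_eq_left hx.le, max_eq_right hx.le]
  · have h1 : HasDerivAt (fun x => (gauss x)⁻¹ * (lowerMass z * upperMass x) / gaussMass)
        (steinDeriv z w) w := by
      refine (((hasDerivAt_gauss_inv w).fun_mul
        ((hasDerivAt_upperMass w).const_mul (lowerMass z))).div_const gaussMass).congr_deriv ?_
      simp only [steinDeriv, steinSol, min_eq_right h, max_eq_left h, if_neg h.not_gt]
      field_simp
      ring
    refine h1.hasDerivWithinAt.congr (fun x hx => ?_) ?_
    · have hx : z ≤ x := h.trans hx
      simp only [steinSol, min_eq_right hx, max_eq_left hx]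
    · simp only [steinSol, min_eq_right h, max_eq_left h]

lemma steinSol_nonneg (z w : ℝ) : 0 ≤ steinSol z w :=
  div_nonneg (mul_nonneg (inv_nonneg.2 (gauss_pos w).le)
    (mul_nonneg (lowerMass_nonneg _) (upperMass_nonneg _))) gaussMass_pos.le

lemma steinSol_le_lowerMass (z w : ℝ) : steinSol z w ≤ (gauss w)⁻¹ * lowerMass w := by
  unfold steinSol
  rw [div_le_iff₀ gaussMass_pos, mul_assoc]
  exact mul_le_mul_of_nonneg_left (mul_le_mul (lowerMass_mono (min_le_left _ _))
    (upperMass_le _) (upperMass_nonneg _) (lowerMass_nonneg _)) (inv_nonneg.2 (gauss_pos w).le)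

lemma steinSol_le_upperMass (z w : ℝ) : steinSol z w ≤ (gauss w)⁻¹ * upperMass w := by
  unfold steinSol
  rw [div_le_iff₀ gaussMass_pos, mul_assoc, mul_comm (lowerMass _)]
  exact mul_le_mul_of_nonneg_left (mul_le_mul (upperMass_anti (le_max_left _ _))
    (lowerMass_le _) (lowerMass_nonneg _) (upperMass_nonneg _)) (inv_nonneg.2 (gauss_pos w).le)

lemma abs_mul_steinSol_le (z w : ℝ) : |w * steinSol z w| ≤ 1 := by
  have hg := gauss_pos w
  rw [abs_mul, abs_of_nonneg (steinSol_nonneg z w)]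
  rcases le_total 0 w with h | h
  · rw [abs_of_nonneg h]
    calc w * steinSol z w ≤ w * ((gauss w)⁻¹ * upperMass w) :=
          mul_le_mul_of_nonneg_left (steinSol_le_upperMass z w) h
      _ = (gauss w)⁻¹ * (w * upperMass w) := by ring
      _ ≤ (gauss w)⁻¹ * gauss w := by gcongr; exact mul_upperMass_le w
      _ = 1 := inv_mul_cancel₀ hg.ne'
  · rw [abs_of_nonpos h]
    calc -w * steinSol z w ≤ -w * ((gauss w)⁻¹ * lowerMass w) :=
          mul_le_mul_of_nonneg_left (steinSol_le_lowerMass z w) (by linarith)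
      _ = (gauss w)⁻¹ * (-w * lowerMass w) := by ring
      _ ≤ (gauss w)⁻¹ * gauss w := by gcongr; exact neg_mul_lowerMass_le w
      _ = 1 := inv_mul_cancel₀ hg.ne'

lemma steinSol_le (z w : ℝ) : steinSol z w ≤ 9 := by
  rcases le_total 1 |w| with h | h
  · have h1 := abs_mul_steinSol_le z w
    rw [abs_mul, abs_of_nonneg (steinSol_nonneg z w)] at h1
    nlinarith [steinSol_nonneg z w]
  · have h1 : (gauss w)⁻¹ ≤ 3 := by
      have h2 : w ^ 2 ≤ 1 := by rw [← sq_abs]; nlinarith [abs_nonneg w]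
      rw [gauss, ← Real.exp_neg]
      calc Real.exp (-(-w ^ 2 / 2)) ≤ Real.exp 1 := Real.exp_le_exp.2 (by linarith)
        _ ≤ 3 := Real.exp_one_lt_three.le
    calc steinSol z w ≤ (gauss w)⁻¹ * lowerMass w := steinSol_le_lowerMass z w
      _ ≤ 3 * 3 := mul_le_mul h1 ((lowerMass_le w).trans gaussMass_le_three)
          (lowerMass_nonneg w) (by norm_num)
      _ = 9 := by norm_num

lemma abs_steinDeriv_le (z w : ℝ) : |steinDeriv z w| ≤ 2 := by
  have h1 := abs_le.1 (abs_mul_steinSol_le z w)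
  have h2 : 0 ≤ lowerMass z / gaussMass := div_nonneg (lowerMass_nonneg z) gaussMass_pos.le
  have h3 : lowerMass z / gaussMass ≤ 1 := (div_le_one gaussMass_pos).2 (lowerMass_le z)
  unfold steinDeriv
  split_ifs <;> exact abs_le.2 ⟨by linarith, by linarith⟩

lemma abs_steinSol_sub_le (z u v : ℝ) : |steinSol z v - steinSol z u| ≤ 2 * |v - u| := by
  wlog h : u ≤ v generalizing u v
  · rw [abs_sub_comm, abs_sub_comm v]; exact this v u (le_of_not_ge h)
  rw [abs_of_nonneg (sub_nonneg.2 h)]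
  exact norm_image_sub_le_of_norm_deriv_right_le_segment (continuous_steinSol z).continuousOn
    (fun x _ => hasDerivWithinAt_steinSol z x) (fun x _ => abs_steinDeriv_le z x) v
    (right_mem_Icc.2 h)

lemma abs_mul_steinSol_sub_le (z u v : ℝ) :
    |v * steinSol z v - u * steinSol z u| ≤ (2 * |u| + 9) * |v - u| := by
  have h : v * steinSol z v - u * steinSol z u
      = u * (steinSol z v - steinSol z u) + (v - u) * steinSol z v := by ring
  rw [h]
  refine (abs_add_le _ _).trans ?_
  rw [abs_mul, abs_mul, abs_of_nonneg (steinSol_nonneg z v)]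
  nlinarith [mul_le_mul_of_nonneg_left (abs_steinSol_sub_le z u v) (abs_nonneg u),
    mul_le_mul_of_nonneg_left (steinSol_le z v) (abs_nonneg (v - u))]

/-- Increments of `steinSol z` are bounded above by a bound for its right derivative; the factor
`r - l` on both sides makes the statement independent of the order of `l` and `r`. -/
lemma mul_steinSol_sub_le {z l r U : ℝ} (hU : ∀ x ∈ uIcc l r, steinDeriv z x ≤ U) :
    (r - l) * (steinSol z r - steinSol z l) ≤ U * (r - l) ^ 2 := by
  wlog h : l ≤ r generalizing l r
  · have := this (by rwa [uIcc_comm]) (le_of_not_ge h)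
    linarith
  rw [uIcc_of_le h] at hU
  have h1 : steinSol z r ≤ steinSol z l + U * (r - l) :=
    image_le_of_deriv_right_le_deriv_boundary (B := fun x => steinSol z l + U * (x - l))
      (B' := fun _ => U) (continuous_steinSol z).continuousOn
      (fun x _ => hasDerivWithinAt_steinSol z x) (by simp) (by fun_prop)
      (fun x _ => by
        simpa using ((((hasDerivAt_id x).sub_const l).const_mul U).const_add
          (steinSol z l)).hasDerivWithinAt)
      (fun x hx => hU x (Ico_subset_Icc_self hx)) (right_mem_Icc.2 h)
  nlinarith [mul_le_mul_of_nonneg_left h1 (sub_nonneg.2 h)]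

lemma le_mul_steinSol_sub {z l r U : ℝ} (hU : ∀ x ∈ uIcc l r, U ≤ steinDeriv z x) :
    U * (r - l) ^ 2 ≤ (r - l) * (steinSol z r - steinSol z l) := by
  wlog h : l ≤ r generalizing l r
  · have := this (by rwa [uIcc_comm]) (le_of_not_ge h)
    linarith
  rw [uIcc_of_le h] at hU
  have h1 : -steinSol z r ≤ -steinSol z l - U * (r - l) :=
    image_le_of_deriv_right_le_deriv_boundary (f := fun x => -steinSol z x)
      (f' := fun x => -steinDeriv z x) (B := fun x => -steinSol z l - U * (x - l))
      (B' := fun _ => -U) (continuous_steinSol z).neg.continuousOn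
      (fun x _ => (hasDerivWithinAt_steinSol z x).neg) (by simp) (by fun_prop)
      (fun x _ => by
        simpa using ((((hasDerivAt_id x).sub_const l).const_mul U).const_sub
          (-steinSol z l)).hasDerivWithinAt)
      (fun x hx => neg_le_neg (hU x (Ico_subset_Icc_self hx))) (right_mem_Icc.2 h)
  nlinarith [mul_le_mul_of_nonneg_left h1 (sub_nonneg.2 h)]

section Expect

/-! ### Expectations under the biased product distribution -/

variable {ι : Type*} [Fintype ι] [DecidableEq ι]

/-- The expectation of `F x` for `x` drawn from the product of the `p`-biased distributions on
`{-1, 1}` over an arbitrary finite index type; over `Fin n` this is `biasedExp`. -/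
noncomputable def expect (p : ℝ) (F : (ι → ℤˣ) → ℝ) : ℝ :=
  ∑ x, (∏ i, biasedWeight p (x i)) * F x

lemma units_univ : (Finset.univ : Finset ℤˣ) = {1, -1} := by decide

lemma biasedWeight_one (p : ℝ) : biasedWeight p 1 = p := if_pos rfl

lemma biasedWeight_neg_one (p : ℝ) : biasedWeight p (-1) = 1 - p := if_neg (by decide)

lemma sum_units (F : ℤˣ → ℝ) : ∑ b, F b = F 1 + F (-1) := by
  rw [units_univ, Finset.sum_pair (by decide)]

lemma sum_biasedWeight (p : ℝ) : ∑ b, biasedWeight p b = 1 := by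
  rw [sum_units, biasedWeight_one, biasedWeight_neg_one]; ring

lemma biasedWeight_nonneg {p : ℝ} (h0 : 0 < p) (h1 : p < 1) (b : ℤˣ) : 0 ≤ biasedWeight p b := by
  unfold biasedWeight; split_ifs <;> linarith

lemma expect_add (p : ℝ) (F G : (ι → ℤˣ) → ℝ) :
    expect p (fun x => F x + G x) = expect p F + expect p G := by
  simp only [expect, mul_add, Finset.sum_add_distrib]

lemma expect_sub (p : ℝ) (F G : (ι → ℤˣ) → ℝ) :
    expect p (fun x => F x - G x) = expect p F - expect p G := by
  simp only [expect, mul_sub, Finset.sum_sub_distrib]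

lemma expect_const_mul (p c : ℝ) (F : (ι → ℤˣ) → ℝ) :
    expect p (fun x => c * F x) = c * expect p F := by
  simp only [expect, Finset.mul_sum]
  exact Finset.sum_congr rfl fun x _ => by ring

lemma expect_sum {κ : Type*} (s : Finset κ) (p : ℝ) (F : κ → (ι → ℤˣ) → ℝ) :
    expect p (fun x => ∑ k ∈ s, F k x) = ∑ k ∈ s, expect p (F k) := by
  simp only [expect, Finset.mul_sum]
  exact Finset.sum_comm

lemma expect_const (p c : ℝ) : expect p (fun _ : ι → ℤˣ => c) = c := by
  simp only [expect, ← Finset.sum_mul]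
  rw [← Fintype.prod_sum fun (_ : ι) b => biasedWeight p b]
  simp only [sum_biasedWeight, Finset.prod_const_one, one_mul]

lemma expect_mono {p : ℝ} (h0 : 0 < p) (h1 : p < 1) {F G : (ι → ℤˣ) → ℝ}
    (h : ∀ x, F x ≤ G x) : expect p F ≤ expect p G :=
  Finset.sum_le_sum fun x _ => mul_le_mul_of_nonneg_left (h x)
    (Finset.prod_nonneg fun _ _ => biasedWeight_nonneg h0 h1 _)

/-- Resampling a single coordinate does not change an expectation. -/
lemma expect_update (p : ℝ) (i : ι) (F : (ι → ℤˣ) → ℝ) :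
    expect p F = expect p fun x =>
      p * F (Function.update x i 1) + (1 - p) * F (Function.update x i (-1)) := by
  -- Exchanging the resampled value with the old one preserves the joint weight.
  let e : (ι → ℤˣ) × ℤˣ ≃ (ι → ℤˣ) × ℤˣ := Function.Involutive.toPerm
    (fun q => (Function.update q.1 i q.2, q.1 i)) fun q => by simp
  have he : ∀ q, e q = (Function.update q.1 i q.2, q.1 i) := fun _ => rfl
  have key : ∀ q : (ι → ℤˣ) × ℤˣ, (∏ j, biasedWeight p (q.1 j)) * biasedWeight p q.2
      = (∏ j, biasedWeight p ((e q).1 j)) * biasedWeight p (e q).2 := fun q => by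
    rw [Fintype.prod_eq_mul_prod_compl i, Fintype.prod_eq_mul_prod_compl i]
    have h : ∀ j ∈ ({i} : Finset ι)ᶜ, biasedWeight p ((e q).1 j) = biasedWeight p (q.1 j) :=
      fun j hj => by
        have hj : j ≠ i := by simpa using hj
        simp [he, hj]
    rw [Finset.prod_congr rfl h]
    simp only [he, Function.update_self]
    ring
  have hL : expect p F = ∑ q : (ι → ℤˣ) × ℤˣ,
      (∏ j, biasedWeight p (q.1 j)) * biasedWeight p q.2 * F q.1 := by
    rw [Fintype.sum_prod_type]
    refine Finset.sum_congr rfl fun x _ => ?_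
    rw [sum_units, biasedWeight_one, biasedWeight_neg_one]; ring
  have hR : (expect p fun x =>
      p * F (Function.update x i 1) + (1 - p) * F (Function.update x i (-1)))
      = ∑ q : (ι → ℤˣ) × ℤˣ,
        (∏ j, biasedWeight p (q.1 j)) * biasedWeight p q.2 * F (e q).1 := by
    rw [Fintype.sum_prod_type]
    refine Finset.sum_congr rfl fun x _ => ?_
    rw [sum_units, biasedWeight_one, biasedWeight_neg_one]
    simp only [he]
    ring
  rw [hL, hR, ← Equiv.sum_comp e]
  exact Finset.sum_congr rfl fun q _ => by rw [← key q]

/-- Fubini: an expectation can be taken over the coordinates satisfying `P` last. -/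
lemma expect_split (p : ℝ) (P : ι → Prop) [DecidablePred P] (F : (ι → ℤˣ) → ℝ) :
    expect p F = expect p fun y : {i // P i} → ℤˣ => expect p fun z : {i // ¬P i} → ℤˣ =>
      F ((Equiv.piEquivPiSubtypeProd P fun _ => ℤˣ).symm (y, z)) := by
  simp only [expect, Finset.mul_sum]
  rw [← Fintype.sum_prod_type', ← Equiv.sum_comp (Equiv.piEquivPiSubtypeProd P fun _ => ℤˣ)]
  refine Finset.sum_congr rfl fun x _ => ?_
  rw [← Fintype.prod_subtype_mul_prod_subtype P]
  simp only [Prod.mk.eta, Equiv.symm_apply_apply, ← mul_assoc]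
  rfl

/-! ### Normalized bits and linear forms in them -/

lemma biasedSD_pos {p : ℝ} (h0 : 0 < p) (h1 : p < 1) : 0 < biasedSD p :=
  mul_pos two_pos (Real.sqrt_pos.2 (mul_pos h0 (sub_pos.2 h1)))

lemma biasedSD_sq {p : ℝ} (h0 : 0 < p) (h1 : p < 1) : biasedSD p ^ 2 = 4 * (p * (1 - p)) := by
  rw [biasedSD, mul_pow, Real.sq_sqrt (mul_pos h0 (sub_pos.2 h1)).le]; norm_num

lemma normalizedBit_one (p : ℝ) : normalizedBit p 1 = 2 * (1 - p) / biasedSD p := by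
  simp only [normalizedBit, bit, biasedMean, Units.val_one, Int.cast_one]; ring

lemma normalizedBit_neg_one (p : ℝ) : normalizedBit p (-1) = -(2 * p) / biasedSD p := by
  simp only [normalizedBit, bit, biasedMean, Units.val_neg, Units.val_one, Int.cast_neg,
    Int.cast_one]
  ring

lemma normalizedBit_one_sub (p : ℝ) :
    normalizedBit p 1 - normalizedBit p (-1) = 2 / biasedSD p := by
  rw [normalizedBit_one, normalizedBit_neg_one]; ring

lemma abs_normalizedBit_sub_le {p : ℝ} (h0 : 0 < p) (h1 : p < 1) (b c : ℤˣ) :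
    |normalizedBit p b - normalizedBit p c| ≤ 2 / biasedSD p := by
  have h := normalizedBit_one_sub p
  have hp : 0 ≤ 2 / biasedSD p := (div_pos two_pos (biasedSD_pos h0 h1)).le
  rcases Int.units_eq_one_or b with rfl | rfl <;> rcases Int.units_eq_one_or c with rfl | rfl
  · simpa using hp
  · rw [h, abs_of_nonneg hp]
  · rw [abs_sub_comm, h, abs_of_nonneg hp]
  · simpa using hp

/-- The discrete integration-by-parts formula for the `p`-biased distribution. -/
lemma expect_normalizedBit_mul {p : ℝ} (h0 : 0 < p) (h1 : p < 1) (i : ι)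
    (F : (ι → ℤˣ) → ℝ) :
    expect p (fun x => normalizedBit p (x i) * F x) = expect p fun x =>
      biasedSD p / 2 * (F (Function.update x i 1) - F (Function.update x i (-1))) := by
  rw [expect_update p i]
  congr 1
  funext x
  have hs := (biasedSD_pos h0 h1).ne'
  have hs2 := biasedSD_sq h0 h1
  simp only [Function.update_self, normalizedBit_one, normalizedBit_neg_one]
  field_simp
  rw [hs2]
  ring

/-- The linear form with coefficients `a` in the normalized bits. -/
noncomputable def linForm (p : ℝ) (a : ι → ℝ) (x : ι → ℤˣ) : ℝ :=
  ∑ i, a i * normalizedBit p (x i)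

lemma linForm_update_sub (p : ℝ) (a : ι → ℝ) (x : ι → ℤˣ) (i : ι) (b c : ℤˣ) :
    linForm p a (Function.update x i b) - linForm p a (Function.update x i c)
      = a i * (normalizedBit p b - normalizedBit p c) := by
  unfold linForm
  rw [← Finset.sum_sub_distrib, Finset.sum_eq_single i]
  · simp; ring
  · intro j _ hj; simp [hj]
  · simp

lemma linForm_update_one_sub (p : ℝ) (a : ι → ℝ) (x : ι → ℤˣ) (i : ι) :
    linForm p a (Function.update x i 1) - linForm p a (Function.update x i (-1))
      = a i * (2 / biasedSD p) := by
  rw [linForm_update_sub, normalizedBit_one_sub]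

lemma expect_linForm_mul {p : ℝ} (h0 : 0 < p) (h1 : p < 1) (a : ι → ℝ) (F : (ι → ℤˣ) → ℝ) :
    expect p (fun x => linForm p a x * F x) = ∑ i, expect p fun x =>
      a i * (biasedSD p / 2 * (F (Function.update x i 1) - F (Function.update x i (-1)))) := by
  simp only [linForm, Finset.sum_mul, mul_assoc]
  rw [expect_sum]
  simp only [expect_const_mul _ (a _), expect_normalizedBit_mul h0 h1]

lemma expect_linForm_sq {p : ℝ} (h0 : 0 < p) (h1 : p < 1) (a : ι → ℝ) :
    expect p (fun x => linForm p a x ^ 2) = ∑ i, a i ^ 2 := by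
  have hs := (biasedSD_pos h0 h1).ne'
  simp only [sq (linForm _ _ _)]
  rw [expect_linForm_mul h0 h1]
  refine Finset.sum_congr rfl fun i _ => ?_
  simp only [linForm_update_one_sub]
  rw [expect_const]
  field_simp

lemma expect_abs_linForm_le {p : ℝ} (h0 : 0 < p) (h1 : p < 1) (a : ι → ℝ) :
    expect p (fun x => |linForm p a x|) ≤ √(∑ i, a i ^ 2) := by
  refine Real.le_sqrt_of_sq_le ?_
  rw [← expect_linForm_sq h0 h1]
  -- The variance of `|linForm p a x|` is nonnegative.
  set m := expect p fun x => |linForm p a x| with hm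
  have h : 0 ≤ expect p fun x => (|linForm p a x| - m) ^ 2 := by
    rw [← expect_const (ι := ι) p 0]
    exact expect_mono h0 h1 fun x => sq_nonneg _
  have h2 : (fun x => (|linForm p a x| - m) ^ 2)
      = fun x => linForm p a x ^ 2 - (2 * m * |linForm p a x| - m ^ 2) := by
    funext x; rw [← sq_abs (linForm p a x)]; ring
  rw [h2, expect_sub, expect_sub, expect_const_mul, expect_const, ← hm] at h
  nlinarith

/-! ### The Berry–Esseen bound -/

/-- The indicator of `W < z`. -/
noncomputable def below (z W : ℝ) : ℝ := if W < z then 1 else 0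

lemma below_mono {z z' W W' : ℝ} (h : W - z ≥ W' - z') : below z W ≤ below z' W' := by
  unfold below
  split_ifs <;> linarith

lemma abs_linForm_update_sub_le {p τ : ℝ} (h0 : 0 < p) (h1 : p < 1) {a : ι → ℝ}
    (ha : ∀ i, |a i| ≤ τ) (x : ι → ℤˣ) (i : ι) (b : ℤˣ) :
    |linForm p a (Function.update x i b) - linForm p a x| ≤ 2 * τ / biasedSD p := by
  have h := linForm_update_sub p a x i b (x i)
  rw [Function.update_eq_self] at h
  rw [h, abs_mul, mul_comm 2 τ, mul_div_assoc]
  exact mul_le_mul (ha i) (abs_normalizedBit_sub_le h0 h1 _ _) (abs_nonneg _)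
    ((abs_nonneg _).trans (ha i))

lemma abs_sub_le_of_mem_uIcc {l r c d x : ℝ} (hl : |l - c| ≤ d) (hr : |r - c| ≤ d)
    (hx : x ∈ uIcc l r) : |x - c| ≤ d := by
  rw [abs_le] at *
  have := uIcc_subset_Icc (a₂ := c - d) (b₂ := c + d) ⟨by linarith, by linarith⟩
    ⟨by linarith, by linarith⟩ hx
  exact ⟨by linarith [this.1], by linarith [this.2]⟩

lemma expect_error_le {p δ : ℝ} (h0 : 0 < p) (h1 : p < 1) (hδ : 0 ≤ δ) {a : ι → ℝ}
    (hsum : ∑ i, a i ^ 2 = 1) :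
    expect p (fun x => (2 * |linForm p a x| + 9) * δ) ≤ 11 * δ := by
  have h := expect_abs_linForm_le h0 h1 a
  rw [hsum, Real.sqrt_one] at h
  have h2 : (fun x => (2 * |linForm p a x| + 9) * δ)
      = fun x => 2 * δ * |linForm p a x| + 9 * δ := by funext x; ring
  rw [h2, expect_add, expect_const_mul, expect_const]
  nlinarith

/-- Upper half of the Berry–Esseen bound. The discrete integration-by-parts formula writes
`E[W f W]` as a weighted mean of difference quotients of the Stein solution `f` over intervals
around `W` of radius `2 τ / σ_p`, on which Stein's equation bounds the derivative of `f`. -/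
lemma gauss_le_expect_below {p τ : ℝ} (h0 : 0 < p) (h1 : p < 1) (hτ : 0 ≤ τ) {a : ι → ℝ}
    (ha : ∀ i, |a i| ≤ τ) (hsum : ∑ i, a i ^ 2 = 1) (z : ℝ) :
    lowerMass z / gaussMass
      ≤ expect p (fun x => below (z + 2 * τ / biasedSD p) (linForm p a x))
        + 11 * (2 * τ / biasedSD p) := by
  have hs := biasedSD_pos h0 h1
  set δ := 2 * τ / biasedSD p with hδ
  have hδ0 : 0 ≤ δ := by positivity
  set U : (ι → ℤˣ) → ℝ := fun x => linForm p a x * steinSol z (linForm p a x)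
    + ((2 * |linForm p a x| + 9) * δ
      + (below (z + δ) (linForm p a x) - lowerMass z / gaussMass)) with hU
  have hE : expect p (fun x => linForm p a x * steinSol z (linForm p a x)) ≤ expect p U := by
    rw [expect_linForm_mul h0 h1, ← one_mul (expect p U), ← hsum, Finset.sum_mul]
    refine Finset.sum_le_sum fun i _ => ?_
    rw [← expect_const_mul]
    refine expect_mono h0 h1 fun x => ?_
    have hd := linForm_update_one_sub p a x i
    have hk : ∀ X ∈ uIcc (linForm p a (Function.update x i (-1)))
        (linForm p a (Function.update x i 1)), steinDeriv z X ≤ U x := fun X hX => by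
      have hX := abs_sub_le_of_mem_uIcc (abs_linForm_update_sub_le h0 h1 ha x i (-1))
        (abs_linForm_update_sub_le h0 h1 ha x i 1) hX
      have e1 := (abs_le.1 (abs_mul_steinSol_sub_le z (linForm p a x) X)).2
      have e2 : (2 * |linForm p a x| + 9) * |X - linForm p a x|
          ≤ (2 * |linForm p a x| + 9) * δ := by gcongr
      have e3 : below z X ≤ below (z + δ) (linForm p a x) :=
        below_mono (by linarith [(abs_le.1 hX).1])
      change X * steinSol z X + below z X - _ ≤ _
      simp only [hU]
      linarith
    have h := mul_steinSol_sub_le hk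
    rw [hd] at h
    calc a i * (biasedSD p / 2 * (_ - _)) = biasedSD p ^ 2 / 4 * (a i * (2 / biasedSD p) *
          (steinSol z (linForm p a (Function.update x i 1))
            - steinSol z (linForm p a (Function.update x i (-1))))) := by field_simp; ring
      _ ≤ biasedSD p ^ 2 / 4 * (U x * (a i * (2 / biasedSD p)) ^ 2) := by gcongr
      _ = a i ^ 2 * U x := by field_simp; ring
  rw [hU, expect_add, expect_add, expect_sub, expect_const] at hE
  linarith [expect_error_le h0 h1 hδ0 hsum]

/-- Lower half of the Berry–Esseen bound. -/
lemma expect_below_le_gauss {p τ : ℝ} (h0 : 0 < p) (h1 : p < 1) (hτ : 0 ≤ τ) {a : ι → ℝ}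
    (ha : ∀ i, |a i| ≤ τ) (hsum : ∑ i, a i ^ 2 = 1) (z : ℝ) :
    expect p (fun x => below (z - 2 * τ / biasedSD p) (linForm p a x))
      ≤ lowerMass z / gaussMass + 11 * (2 * τ / biasedSD p) := by
  have hs := biasedSD_pos h0 h1
  set δ := 2 * τ / biasedSD p with hδ
  have hδ0 : 0 ≤ δ := by positivity
  set U : (ι → ℤˣ) → ℝ := fun x => linForm p a x * steinSol z (linForm p a x)
    - ((2 * |linForm p a x| + 9) * δ
      - (below (z - δ) (linForm p a x) - lowerMass z / gaussMass)) with hU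
  have hE : expect p U ≤ expect p (fun x => linForm p a x * steinSol z (linForm p a x)) := by
    rw [expect_linForm_mul h0 h1, ← one_mul (expect p U), ← hsum, Finset.sum_mul]
    refine Finset.sum_le_sum fun i _ => ?_
    rw [← expect_const_mul]
    refine expect_mono h0 h1 fun x => ?_
    have hd := linForm_update_one_sub p a x i
    have hk : ∀ X ∈ uIcc (linForm p a (Function.update x i (-1)))
        (linForm p a (Function.update x i 1)), U x ≤ steinDeriv z X := fun X hX => by
      have hX := abs_sub_le_of_mem_uIcc (abs_linForm_update_sub_le h0 h1 ha x i (-1))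
        (abs_linForm_update_sub_le h0 h1 ha x i 1) hX
      have e1 := (abs_le.1 (abs_mul_steinSol_sub_le z (linForm p a x) X)).1
      have e2 : (2 * |linForm p a x| + 9) * |X - linForm p a x|
          ≤ (2 * |linForm p a x| + 9) * δ := by gcongr
      have e3 : below (z - δ) (linForm p a x) ≤ below z X :=
        below_mono (by linarith [(abs_le.1 hX).2])
      change _ ≤ X * steinSol z X + below z X - _
      simp only [hU]
      linarith
    have h := le_mul_steinSol_sub hk
    rw [hd] at h
    calc a i ^ 2 * U x = biasedSD p ^ 2 / 4 * (U x * (a i * (2 / biasedSD p)) ^ 2) := by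
          field_simp; ring
      _ ≤ biasedSD p ^ 2 / 4 * (a i * (2 / biasedSD p) *
          (steinSol z (linForm p a (Function.update x i 1))
            - steinSol z (linForm p a (Function.update x i (-1))))) := by gcongr
      _ = a i * (biasedSD p / 2 * (_ - _)) := by field_simp; ring
  rw [hU, expect_sub, expect_sub, expect_sub, expect_const] at hE
  linarith [expect_error_le h0 h1 hδ0 hsum]

/-- Two linear forms of unit variance with coefficients at most `τ` have distribution functions
at distance `O(τ / σ_p)`, since both are that close to the Gaussian one. -/
lemma expect_below_sub_le {p τ : ℝ} (h0 : 0 < p) (h1 : p < 1) (hτ : 0 ≤ τ) {a b : ι → ℝ}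
    (ha : ∀ i, |a i| ≤ τ) (hb : ∀ i, |b i| ≤ τ) (hasum : ∑ i, a i ^ 2 = 1)
    (hbsum : ∑ i, b i ^ 2 = 1) (z : ℝ) :
    expect p (fun x => below z (linForm p a x)) - expect p (fun x => below z (linForm p b x))
      ≤ 48 * (τ / biasedSD p) := by
  have hs := biasedSD_pos h0 h1
  have e1 := expect_below_le_gauss h0 h1 hτ ha hasum (z + 2 * τ / biasedSD p)
  have e2 := gauss_le_expect_below h0 h1 hτ hb hbsum (z - 2 * τ / biasedSD p)
  rw [add_sub_cancel_right] at e1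
  rw [sub_add_cancel] at e2
  have hδ : 2 * τ / biasedSD p = 2 * (τ / biasedSD p) := by ring
  have hδ0 : 0 ≤ τ / biasedSD p := by positivity
  rw [hδ] at e1 e2
  have e3 := lowerMass_sub_le (u := z - 2 * (τ / biasedSD p)) (v := z + 2 * (τ / biasedSD p))
    (by linarith)
  have e4 : lowerMass (z + 2 * (τ / biasedSD p)) / gaussMass
      - lowerMass (z - 2 * (τ / biasedSD p)) / gaussMass ≤ 4 * (τ / biasedSD p) := by
    rw [← sub_div, div_le_iff₀ gaussMass_pos]
    nlinarith [one_le_gaussMass]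
  linarith

end Expect

section Head

variable {ι : Type*} [Fintype ι]

/-! ### Regular threshold functions and the head coefficients -/

lemma norm1_of_nonneg {v : ι → ℝ} (h : ∀ i, 0 ≤ v i) : norm1 v = ∑ i, v i :=
  Finset.sum_congr rfl fun i _ => abs_of_nonneg (h i)

lemma norm2_pos {v : ι → ℝ} (h : v ≠ 0) : 0 < norm2 v := by
  obtain ⟨i, hi⟩ := Function.ne_iff.1 h
  exact Real.sqrt_pos.2 (Finset.sum_pos' (fun j _ => sq_nonneg _)
    ⟨i, Finset.mem_univ i, pow_pos (abs_pos.2 hi) 2 |>.trans_eq (sq_abs _)⟩)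

lemma sum_div_norm2_sq {v : ι → ℝ} (h : v ≠ 0) : ∑ i, (v i / norm2 v) ^ 2 = 1 := by
  have hN := norm2_pos h
  have hsq : norm2 v ^ 2 = ∑ i, v i ^ 2 :=
    Real.sq_sqrt (Finset.sum_nonneg fun i _ => sq_nonneg (v i))
  simp only [div_pow, ← Finset.sum_div]
  rw [← hsq, div_self (by positivity)]

lemma IsRegular.abs_div_norm2_le {τ : ℝ} {v : ι → ℝ} (h : IsRegular τ v) (i : ι) :
    |v i / norm2 v| ≤ τ := by
  rw [abs_div, abs_of_pos (norm2_pos h.1)]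
  exact (div_le_div_of_nonneg_right (norm_le_pi_norm v i) (norm2_pos h.1).le).trans h.2

lemma IsRegular.nonneg {τ : ℝ} {v : ι → ℝ} (h : IsRegular τ v) : 0 ≤ τ :=
  (div_nonneg (norm_nonneg v) (norm2_pos h.1).le).trans h.2

lemma bit_sign (t : ℝ) : bit (sign t) = 1 - 2 * below 0 t := by
  unfold sign below bit
  split_ifs <;> first | linarith | norm_num

lemma bit_eq {p : ℝ} (h0 : 0 < p) (h1 : p < 1) (b : ℤˣ) :
    bit b = biasedSD p * normalizedBit p b + biasedMean p := by
  have := (biasedSD_pos h0 h1).ne'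
  unfold normalizedBit
  field_simp
  ring

/-- In normalized bits, a weighted sum of bits is an affine function of the linear form with
the `ℓ₂`-normalized weights. -/
lemma below_weightedSum {p : ℝ} (h0 : 0 < p) (h1 : p < 1) {v : ι → ℝ} (hv : v ≠ 0) (s : ℝ)
    (x : ι → ℤˣ) :
    below 0 (s + ∑ i, v i * bit (x i))
      = below (-(s + biasedMean p * ∑ i, v i) / (norm2 v * biasedSD p))
          (linForm p (fun i => v i / norm2 v) x) := by
  have hN := norm2_pos hv
  have hs := biasedSD_pos h0 h1
  have h : s + ∑ i, v i * bit (x i) = linForm p (fun i => v i / norm2 v) x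
      * (norm2 v * biasedSD p) + (s + biasedMean p * ∑ i, v i) := by
    rw [linForm, Finset.sum_mul, add_left_comm, Finset.mul_sum, ← Finset.sum_add_distrib]
    congr 1
    refine Finset.sum_congr rfl fun i _ => ?_
    rw [bit_eq h0 h1]
    field_simp
  unfold below
  rw [h]
  refine if_congr ?_ rfl rfl
  rw [lt_div_iff₀ (by positivity)]
  constructor <;> intro h <;> linarith

variable [DecidableEq ι]

/-- Threshold functions of regular weight vectors with equal `ℓ₂` norm, and the same mean of the
weighted sum, have nearly the same expectation. -/
lemma abs_expect_sign_sub_le {p τ : ℝ} (h0 : 0 < p) (h1 : p < 1) {v v' : ι → ℝ}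
    (hv : IsRegular τ v) (hv' : IsRegular τ v') (hN : norm2 v = norm2 v')
    (hμ : biasedMean p * ∑ i, v i = biasedMean p * ∑ i, v' i) (s : ℝ) :
    |expect p (fun x => bit (sign (s + ∑ i, v i * bit (x i)))
        - bit (sign (s + ∑ i, v' i * bit (x i))))| ≤ 96 * (τ / biasedSD p) := by
  set z := -(s + biasedMean p * ∑ i, v i) / (norm2 v * biasedSD p) with hz
  have e : (fun x : ι → ℤˣ => bit (sign (s + ∑ i, v i * bit (x i)))
        - bit (sign (s + ∑ i, v' i * bit (x i))))
      = fun x => 2 * (below z (linForm p (fun i => v' i / norm2 v') x)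
          - below z (linForm p (fun i => v i / norm2 v) x)) := by
    funext x
    rw [bit_sign, bit_sign, below_weightedSum h0 h1 hv.1, below_weightedSum h0 h1 hv'.1,
      ← hμ, ← hN, ← hz]
    ring
  rw [e, expect_const_mul, expect_sub]
  have a1 := expect_below_sub_le h0 h1 hv.nonneg hv.abs_div_norm2_le hv'.abs_div_norm2_le
    (sum_div_norm2_sq hv.1) (sum_div_norm2_sq hv'.1) z
  have a2 := expect_below_sub_le h0 h1 hv.nonneg hv'.abs_div_norm2_le hv.abs_div_norm2_le
    (sum_div_norm2_sq hv'.1) (sum_div_norm2_sq hv.1) z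
  exact abs_le.2 ⟨by linarith, by linarith⟩

/-- A form of Bessel's inequality: if the conditional expectation of `D` given the coordinates
satisfying `P` is bounded by `ε`, then so is the `ℓ₂` norm of its degree-one coefficients there.
The linear form with these coefficients pairs with `D` to the sum of their squares. -/
lemma sum_expect_mul_normalizedBit_sq_le {p ε : ℝ} (h0 : 0 < p) (h1 : p < 1)
    (P : ι → Prop) [DecidablePred P] (D : (ι → ℤˣ) → ℝ) (hε : 0 ≤ ε)
    (hD : ∀ y : {i // P i} → ℤˣ, |expect p fun z : {i // ¬P i} → ℤˣ =>
      D ((Equiv.piEquivPiSubtypeProd P fun _ => ℤˣ).symm (y, z))| ≤ ε) :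
    ∑ i : {i // P i}, (expect p fun x => D x * normalizedBit p (x i)) ^ 2 ≤ ε ^ 2 := by
  set c : {i // P i} → ℝ := fun i => expect p fun x => D x * normalizedBit p (x i) with hc
  set S := ∑ i, c i ^ 2 with hS
  have hS0 : 0 ≤ S := Finset.sum_nonneg fun i _ => sq_nonneg (c i)
  have e1 : S = expect p fun x : ι → ℤˣ => linForm p c (fun i => x i) * D x := by
    simp only [linForm, Finset.sum_mul]
    rw [expect_sum]
    refine Finset.sum_congr rfl fun i _ => ?_
    rw [sq]
    nth_rewrite 2 [hc]
    rw [← expect_const_mul]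
    congr 1
    funext x
    ring
  have e2 : S ≤ ε * √S := by
    calc S = expect p (fun y : {i // P i} → ℤˣ => linForm p c y *
          expect p fun z : {i // ¬P i} → ℤˣ =>
            D ((Equiv.piEquivPiSubtypeProd P fun _ => ℤˣ).symm (y, z))) := by
          rw [e1, expect_split p P]
          congr 1
          funext y
          rw [← expect_const_mul]
          congr 1
          funext z
          congr 2
          funext i
          simp [Equiv.piEquivPiSubtypeProd, i.2]
      _ ≤ expect p (fun y : {i // P i} → ℤˣ => ε * |linForm p c y|) := by
          refine expect_mono h0 h1 fun y => (le_abs_self _).trans ?_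
          rw [abs_mul, mul_comm]
          exact mul_le_mul_of_nonneg_right (hD y) (abs_nonneg _)
      _ ≤ ε * √S := by
          rw [expect_const_mul]
          exact mul_le_mul_of_nonneg_left (expect_abs_linForm_le h0 h1 c) hε
  have e3 : √S ≤ ε := by
    rcases (Real.sqrt_nonneg S).eq_or_lt with h | h
    · rw [← h]; exact hε
    · refine le_of_mul_le_mul_right ?_ h
      rwa [Real.mul_self_sqrt hS0]
  calc S = √S ^ 2 := (Real.sq_sqrt hS0).symm
    _ ≤ ε ^ 2 := by gcongr

/-- The bound on the head coefficients, whenever the two tail sums have equal means. -/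
lemma sum_biasedCoeff_sub_sq_le {n : ℕ} {H : Finset (Fin n)} {w w' : Fin n → ℝ} {p τ : ℝ}
    (θ : ℝ) (h0 : 0 < p) (h1 : p < 1) (hH : ∀ i ∈ H, w' i = w i)
    (hv : IsRegular τ (tail H w)) (hv' : IsRegular τ (tail H w'))
    (hN : norm2 (tail H w) = norm2 (tail H w'))
    (hμ : biasedMean p * ∑ i, tail H w i = biasedMean p * ∑ i, tail H w' i) :
    ∑ i ∈ H, (biasedCoeff p (ltf w θ) i - biasedCoeff p (ltf w' θ) i) ^ 2
      ≤ 9216 * (τ ^ 2 / biasedSD p ^ 2) := by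
  have hs := biasedSD_pos h0 h1
  have hτ := hv.nonneg
  have e : ∀ i, biasedCoeff p (ltf w θ) i - biasedCoeff p (ltf w' θ) i
      = expect p fun x => (bit (ltf w θ x) - bit (ltf w' θ x)) * normalizedBit p (x i) :=
    fun i => by
      simp only [sub_mul]
      rw [expect_sub]
      rfl
  simp only [e]
  rw [Finset.sum_subtype H fun _ => Iff.rfl]
  refine (sum_expect_mul_normalizedBit_sq_le (ε := 96 * (τ / biasedSD p)) h0 h1 (· ∈ H)
    (fun x => bit (ltf w θ x) - bit (ltf w' θ x)) (by positivity) fun y => ?_).trans_eq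
    (by rw [mul_pow, div_pow]; norm_num)
  -- With the head fixed to `y`, both functions are thresholds of the tail with the same shift.
  have key : ∀ u : Fin n → ℝ, (∀ i ∈ H, u i = w i) → ∀ z : {i // i ∉ H} → ℤˣ,
      ltf u θ ((Equiv.piEquivPiSubtypeProd (· ∈ H) fun _ => ℤˣ).symm (y, z))
        = sign ((∑ i : {i // i ∈ H}, w i * bit (y i) - θ) + ∑ i, tail H u i * bit (z i)) :=
    fun u hu z => by
      unfold ltf
      rw [← Fintype.sum_subtype_add_sum_subtype (· ∈ H), add_sub_right_comm]
      refine congrArg sign (congrArg₂ _ (congrArg (· - θ) ?_) ?_)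
      · refine Finset.sum_congr (Finset.ext fun _ => by simp) fun i _ => ?_
        simp [Equiv.piEquivPiSubtypeProd, hu i i.2]
      · refine Finset.sum_congr (Finset.ext fun _ => by simp) fun i _ => ?_
        simp [Equiv.piEquivPiSubtypeProd, i.2, tail]
  simp only [key w fun _ _ => rfl, key w' hH]
  exact abs_expect_sign_sub_le h0 h1 hv hv' hN hμ _

end Head

end LTF

theorem mainTheorem7 :
    ∃ C : ℝ, 0 < C ∧
      ∀ (n : ℕ) (H : Finset (Fin n)) (w w' : Fin n → ℝ) (θ τ : ℝ),
        (∀ i ∈ H, w' i = w i) →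
        (∀ i, 0 ≤ w i) →
        LTF.IsRegular τ (LTF.tail H w) →
        LTF.IsRegular τ (LTF.tail H w') →
        LTF.norm2 (LTF.tail H w) = LTF.norm2 (LTF.tail H w') →
        (∀ p : ℝ, 0 < p → p < 1 →
          (∀ i, 0 ≤ w' i) →
          LTF.norm1 (LTF.tail H w) = LTF.norm1 (LTF.tail H w') →
          ∑ i ∈ H, (LTF.biasedCoeff p (LTF.ltf w θ) i
              - LTF.biasedCoeff p (LTF.ltf w' θ) i) ^ 2
            ≤ C * (τ ^ 2 / LTF.biasedSD p ^ 2)) ∧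
        ∑ i ∈ H, (LTF.biasedCoeff (1 / 2) (LTF.ltf w θ) i
            - LTF.biasedCoeff (1 / 2) (LTF.ltf w' θ) i) ^ 2
          ≤ C * (τ ^ 2 / LTF.biasedSD (1 / 2) ^ 2) := by
  refine ⟨9216, by norm_num, fun n H w w' θ τ hH hw hv hv' hN => ⟨fun p h0 h1 hw' h => ?_, ?_⟩⟩
  · rw [LTF.norm1_of_nonneg (v := LTF.tail H w) fun i => hw i,
      LTF.norm1_of_nonneg (v := LTF.tail H w') fun i => hw' i] at h
    exact LTF.sum_biasedCoeff_sub_sq_le θ h0 h1 hH hv hv' hN (by rw [h])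
  · exact LTF.sum_biasedCoeff_sub_sq_le θ (by norm_num) (by norm_num) hH hv hv' hN
      (by norm_num [LTF.biasedMean])
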